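/- Let $G=(V,E)$ be a finite directed graph with real edge capacities $c_{ij}$ and linear edge costs $f_{ij}\in\mathbb R$ for $(i,j)\in E$. Let $S\subseteq V$ be a set of source nodes with storage costs $d_i\ge 0$ ($i\in S$), let $T\subseteq V$ be a nonempty set of terminals, and let $h$ be the entropy of the original source. Let $G^*=(V^*,E^*)$ be obtained from $G$ by adding a node $s^*$ and an edge $(s^*,i)$ for every $i\in S$; put $c^*_{ij}=c_{ij}$ on $E$ and $c^*_{s^*i}=\infty$. For $t\in T$ let $\sigma^{(t)}_{s^*}=h$, $\sigma^{(t)}_t=-h$, and $\sigma^{(t)}_i=0$ otherwise. The flow constraints on real variables $x^{(t)}_{ij},z_{ij}$ are $$0\le x^{(t)}_{ij}\le z_{ij}\le c^*_{ij}\quad((i,j)\in E^*,\ t\in T),\qquad \sum_{j:(i,j)\in E^*}x^{(t)}_{ij}-\sum_{j:(j,i)\in E^*}x^{(t)}_{ji}=\sigma^{(t)}_i\quad(i\in V^*,\ t\in T).\tag{F}$$ CODED-MIN-COST is the problem of minimizing $\sum_{(i,j)\in E}f_{ij}z_{ij}+\sum_{i\in S}d_iz_{s^*i}$ over all $x,z$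 satisfying (F). SUBSET-MIN-COST has in addition real variables $R^{(t)}_i$ ($i\in S$, $t\in T$) and one real variable $\mu^*(A)$ for each nonempty atom $A$ of the field generated by sets $\widetilde X_i$, $i\in S$, in general position (the atoms $\bigcap_{i\in B}\widetilde X_i\cap\bigcap_{i\in S\setminus B}\widetilde X_i^{\,c}$ with $\emptyset\ne B\subseteq S$). Let $\mathcal A$ be the set of these atoms, $\widetilde X_U=\bigcup_{i\in U}\widetilde X_i$, $H(X_i)=\sum_{A\in\mathcal A,\,A\subseteq\widetilde X_i}\mu^*(A)$ and $H(X_U|X_{S\setminus U})=\sum_{A\in\mathcal A,\,A\not\subseteq\widetilde X_{S\setminus U}}\mu^*(A)$. The problem is to minimize $$\sum_{(i,j)\in E}f_{ij}z_{ij}+\sum_{A\in\mathcal A}\Big(\sum_{i\in S:\,A\subseteq\widetilde X_i}d_i\Big)\mu^*(A)$$ subject to (F), $x^{(t)}_{s^*i}\ge R^{(t)}_i$ for $i\in S$ and $t\in T$, $\sum_{i\in U}R^{(t)}_i\ge H(X_U|X_{S\setminus U})$ for $U\subseteq S$ and $t\in T$, $\mu^*(A)\ge 0$ for $A\in\mathcal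 A$, $z_{s^*i}=H(X_i)$ for $i\in S$, and $\sum_{A\in\mathcal A}\mu^*(A)=h$. Suppose that there are two source nodes, $|S|=2$. Let $f_{opt2}$ be the optimal value of SUBSET-MIN-COST and $f_{opt1}$ the optimal value of CODED-MIN-COST (each being $+\infty$ if the problem is infeasible). Then $f_{opt2}=f_{opt1}$. Moreover, one problem is feasible if and only if the other is, and in that case both minima are attained. -/

import Mathlib

/-- The data of a content distribution problem: a finite directed graph with vertex set `V`, edge
set `E`, capacities `cap` and linear flow costs `f` on the edges, a set `S` of source nodes with
linear storage costs `d`, a set `T` of terminals, and the entropy `h` of the original source,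
i.e. the joint entropy of the sources. Values of `cap`, `f` off `E` and of `d` off `S` are never
used. -/
structure DistributionNetwork (V : Type*) where
  E : Finset (V × V)
  cap : V × V → ℝ
  S : Finset V
  T : Finset V
  f : V × V → ℝ
  d : V → ℝ
  h : ℝ

namespace DistributionNetwork

variable {V : Type*} [DecidableEq V] (N : DistributionNetwork V)

/-- The edges of the augmented graph `G*`: its vertices are `Option V`, where `none` is the virtual
super node `s*`. The edges are those of `G`, together with an edge `(s*, i)` for each source
`i`. -/
def augEdges : Finset (Option V × Option V) :=
  N.E.image (fun e => (some e.1, some e.2)) ∪ N.S.image (fun i => (none, some i))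

/-- The capacities of the augmented graph: those of `G`, and infinity on the virtual edges. -/
noncomputable def augCap : Option V × Option V → EReal
  | (some u, some v) => (N.cap (u, v) : EReal)
  | _ => ⊤

/-- The supply `σ_i^{(t)}`: `h` at `s*`, `-h` at the terminal `t`, and `0` at other vertices. -/
def supply (t : V) (i : Option V) : ℝ :=
  if i = none then N.h else if i = some t then -N.h else 0

/-- The flow constraints common to both problems: for each terminal `t`, `x t` is a flow of value
`h` from `s*` to `t` in the augmented graph, and `z` dominates all these flows and respects the
capacities. -/
def IsMulticastFlow (x : V → Option V × Option V → ℝ) (z : Option V × Option V → ℝ) : Prop :=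
  (∀ e ∈ N.augEdges, ∀ t ∈ N.T, 0 ≤ x t e ∧ x t e ≤ z e ∧ (z e : EReal) ≤ N.augCap e) ∧
  (∀ i : Option V, ∀ t ∈ N.T,
    ∑ e ∈ N.augEdges with e.1 = i, x t e - ∑ e ∈ N.augEdges with e.2 = i, x t e = N.supply t i)

/-- The flow cost `∑_{(i,j) ∈ E} f_{ij} z_{ij}`. -/
def flowCost (z : Option V × Option V → ℝ) : ℝ :=
  ∑ e ∈ N.E, N.f e * z (some e.1, some e.2)

/-- The nonempty atoms of the field generated by the sets `X̃_i`, `i ∈ S`. The atom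
`⋂_{i ∈ A} X̃_i ∩ ⋂_{i ∈ S \ A} X̃_iᶜ` is represented by the nonempty set `A ⊆ S`. Thus the atom is
contained in `X̃_i` iff `i ∈ A`, and it is contained in `X̃_U = ⋃_{i ∈ U} X̃_i` iff `A` meets
`U`. -/
def atoms : Finset (Finset V) := N.S.powerset.filter Finset.Nonempty

/-- `H(X_i)`, the sum of the measures of the atoms contained in `X̃_i`. -/
def entropy (μ : Finset V → ℝ) (i : V) : ℝ := ∑ A ∈ N.atoms with i ∈ A, μ A

/-- `H(X_1, …, X_n)`, the sum of the measures of all nonempty atoms. -/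
def jointEntropy (μ : Finset V → ℝ) : ℝ := ∑ A ∈ N.atoms, μ A

/-- `H(X_U | X_{S \ U})`, the sum of the measures of the atoms not contained in `X̃_{S \ U}`. -/
def condEntropy (μ : Finset V → ℝ) (U : Finset V) : ℝ :=
  ∑ A ∈ N.atoms with Disjoint A (N.S \ U), μ A

/-- Membership of the rate vector `R` in the Slepian-Wolf region of the sources. -/
def InSlepianWolf (μ : Finset V → ℝ) (R : V → ℝ) : Prop :=
  ∀ U ⊆ N.S, N.condEntropy μ U ≤ ∑ i ∈ U, R i

/-- The constraints of SUBSET-MIN-COST, in the variables `x`, `z`, `R` and the atom measures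
`μ`. -/
def SubsetFeasible (x : V → Option V × Option V → ℝ) (z : Option V × Option V → ℝ)
    (R : V → V → ℝ) (μ : Finset V → ℝ) : Prop :=
  N.IsMulticastFlow x z ∧
  (∀ i ∈ N.S, ∀ t ∈ N.T, R t i ≤ x t (none, some i)) ∧
  (∀ t ∈ N.T, N.InSlepianWolf μ (R t)) ∧
  (∀ A ∈ N.atoms, 0 ≤ μ A) ∧
  (∀ i ∈ N.S, z (none, some i) = N.entropy μ i) ∧
  N.h = N.jointEntropy μ

/-- The objective of SUBSET-MIN-COST. -/
def subsetCost (z : Option V × Option V → ℝ) (μ : Finset V → ℝ) : ℝ :=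
  N.flowCost z + ∑ A ∈ N.atoms, (∑ i ∈ N.S with i ∈ A, N.d i) * μ A

/-- The objective of CODED-MIN-COST. -/
def codedCost (z : Option V × Option V → ℝ) : ℝ :=
  N.flowCost z + ∑ i ∈ N.S, N.d i * z (none, some i)

/-- The objective values of the feasible points of SUBSET-MIN-COST. -/
def subsetValues : Set ℝ :=
  {c | ∃ x z R μ, N.SubsetFeasible x z R μ ∧ N.subsetCost z μ = c}

/-- The objective values of the feasible points of CODED-MIN-COST. -/
def codedValues : Set ℝ :=
  {c | ∃ x z, N.IsMulticastFlow x z ∧ N.codedCost z = c}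

/-- The optimal value of SUBSET-MIN-COST (`⊤` if the problem is infeasible). -/
noncomputable def subsetMinCost : EReal := sInf ((fun c : ℝ => (c : EReal)) '' N.subsetValues)

/-- The optimal value of CODED-MIN-COST (`⊤` if the problem is infeasible). -/
noncomputable def codedMinCost : EReal := sInf ((fun c : ℝ => (c : EReal)) '' N.codedValues)

end DistributionNetwork

namespace DistributionNetwork

variable {V : Type*} [DecidableEq V] {N : DistributionNetwork V}
  {x : V → Option V × Option V → ℝ} {z : Option V × Option V → ℝ}

/-! On points feasible for SUBSET-MIN-COST the two objectives agree, because `z` on a virtual edge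
is the source entropy; hence `subsetValues ⊆ codedValues`. Conversely, the virtual flows towards a
terminal are nonnegative with sum `h`, so each is at most `h`, and since `d ≥ 0` the virtual `z` may
be truncated at `h` without raising the cost (`exists_normalized`). For two sources, an atom measure
with marginals `z_a`, `z_b` and total `h` then exists, and the virtual flows themselves serve as
Slepian-Wolf rates (`exists_subsetFeasible`). Attainment follows by compactness for CODED-MIN-COST
and carries over, since a coded minimizer is matched by a subset value that is no larger. -/

theorem virtual_mem_augEdges {i : V} (hi : i ∈ N.S) : (none, some i) ∈ N.augEdges := by
  simp [augEdges, hi]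

theorem edge_mem_augEdges {e : V × V} (he : e ∈ N.E) : (some e.1, some e.2) ∈ N.augEdges := by
  simp [augEdges, he]

theorem augEdges_cases {e : Option V × Option V} (he : e ∈ N.augEdges) :
    (∃ u v, (u, v) ∈ N.E ∧ e = (some u, some v)) ∨ ∃ i ∈ N.S, e = (none, some i) := by
  simp only [augEdges, Finset.mem_union, Finset.mem_image] at he
  rcases he with ⟨a, ha, rfl⟩ | ⟨i, hi, rfl⟩
  · exact Or.inl ⟨a.1, a.2, ha, rfl⟩
  · exact Or.inr ⟨i, hi, rfl⟩

/-- The flow on the virtual edges adds up to `h`. -/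
theorem IsMulticastFlow.sum_virtual (hf : N.IsMulticastFlow x z) {t : V} (ht : t ∈ N.T) :
    ∑ i ∈ N.S, x t (none, some i) = N.h := by
  have h := hf.2 none t ht
  have hout : N.augEdges.filter (fun e => e.1 = none) = N.S.image (fun i => (none, some i)) := by
    ext ⟨a, b⟩
    simp only [augEdges, Finset.mem_filter, Finset.mem_union, Finset.mem_image, Prod.mk.injEq]
    aesop
  have hin : N.augEdges.filter (fun e => e.2 = none) = ∅ := by
    ext ⟨a, b⟩
    simp only [augEdges, Finset.mem_filter, Finset.mem_union, Finset.mem_image, Prod.mk.injEq]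
    aesop
  rw [hout, hin, Finset.sum_image (by intro a _ b _ hab; simpa using hab)] at h
  simpa [supply] using h

theorem IsMulticastFlow.virtual_le (hf : N.IsMulticastFlow x z) {t : V} (ht : t ∈ N.T) {i : V}
    (hi : i ∈ N.S) : x t (none, some i) ≤ N.h := by
  rw [← hf.sum_virtual ht]
  exact Finset.single_le_sum (f := fun i => x t (none, some i))
    (fun j hj => (hf.1 _ (virtual_mem_augEdges hj) t ht).1) hi

theorem IsMulticastFlow.entropy_nonneg (hf : N.IsMulticastFlow x z) (hT : N.T.Nonempty) :
    0 ≤ N.h := by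
  obtain ⟨t, ht⟩ := hT
  rw [← hf.sum_virtual ht]
  exact Finset.sum_nonneg fun j hj => (hf.1 _ (virtual_mem_augEdges hj) t ht).1

/-- A bound for the entries of the normalized feasible points. -/
noncomputable def flowBound (N : DistributionNetwork V) : ℝ := N.h + ∑ e ∈ N.E, |N.cap e|

/-- Every feasible point of CODED-MIN-COST can be replaced by one that is no more expensive, has
entries in `[0, flowBound]` and stores at most `h` at each source. -/
theorem IsMulticastFlow.exists_normalized (hf : N.IsMulticastFlow x z) (hT : N.T.Nonempty)
    (hd : ∀ i ∈ N.S, 0 ≤ N.d i) :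
    ∃ x' z', N.IsMulticastFlow x' z' ∧ (∀ t e, x' t e ∈ Set.Icc 0 N.flowBound) ∧
      (∀ e, z' e ∈ Set.Icc 0 N.flowBound) ∧ (∀ i ∈ N.S, z' (none, some i) ≤ N.h) ∧
      N.codedCost z' ≤ N.codedCost z := by
  have hh := hf.entropy_nonneg hT
  have hC : N.h ≤ N.flowBound :=
    le_add_of_nonneg_right (Finset.sum_nonneg fun e _ => abs_nonneg _)
  -- Entries outside `T` and `augEdges` are unconstrained; zeroing them puts every coordinate into a
  -- bounded interval.
  set x' : V → Option V × Option V → ℝ :=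
    fun t e => if t ∈ N.T ∧ e ∈ N.augEdges then x t e else 0 with hx'
  set z' : Option V × Option V → ℝ :=
    fun e => if e ∈ N.augEdges then (if e.1 = none then min (z e) N.h else z e) else 0 with hz'
  have hxx : ∀ t ∈ N.T, ∀ e ∈ N.augEdges, x' t e = x t e := fun t ht e he => by
    simp [hx', ht, he]
  have hzv : ∀ i ∈ N.S, z' (none, some i) = min (z (none, some i)) N.h := fun i hi => by
    simp [hz', virtual_mem_augEdges hi]
  have hze : ∀ u v, (u, v) ∈ N.E → z' (some u, some v) = z (some u, some v) := fun u v he => by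
    simp [hz', edge_mem_augEdges he]
  have hflow : N.IsMulticastFlow x' z' := by
    refine ⟨fun e he t ht => ?_, fun i t ht => ?_⟩
    · rw [hxx t ht e he]
      obtain ⟨h0, h1, h2⟩ := hf.1 e he t ht
      rcases augEdges_cases he with ⟨u, v, huv, rfl⟩ | ⟨i, hi, rfl⟩
      · rw [hze u v huv]
        exact ⟨h0, h1, h2⟩
      · rw [hzv i hi]
        exact ⟨h0, le_min h1 (hf.virtual_le ht hi), le_top⟩
    · rw [← hf.2 i t ht]
      congr 1 <;> exact Finset.sum_congr rfl fun e he => hxx t ht e (Finset.mem_filter.1 he).1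
  have hzle : ∀ e ∈ N.augEdges, z' e ≤ N.flowBound := fun e he => by
    -- The capacity bound on `z'` is stated per terminal, so one terminal is needed to extract it.
    obtain ⟨t, ht⟩ := hT
    rcases augEdges_cases he with ⟨u, v, huv, rfl⟩ | ⟨i, hi, rfl⟩
    · have h1 : z' (some u, some v) ≤ N.cap (u, v) :=
        EReal.coe_le_coe_iff.1 (hflow.1 _ he t ht).2.2
      have h2 : |N.cap (u, v)| ≤ ∑ e ∈ N.E, |N.cap e| :=
        Finset.single_le_sum (f := fun e => |N.cap e|) (fun e _ => abs_nonneg _) huv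
      have h3 := le_abs_self (N.cap (u, v))
      unfold flowBound
      linarith
    · rw [hzv i hi]
      exact (min_le_right _ _).trans hC
  refine ⟨x', z', hflow, fun t e => ?_, fun e => ?_, fun i hi => ?_, ?_⟩
  · by_cases hte : t ∈ N.T ∧ e ∈ N.augEdges
    · obtain ⟨h0, h1, -⟩ := hflow.1 e hte.2 t hte.1
      exact ⟨h0, h1.trans (hzle e hte.2)⟩
    · simp only [hx', if_neg hte]
      exact ⟨le_rfl, hh.trans hC⟩
  · by_cases he : e ∈ N.augEdges
    · obtain ⟨t, ht⟩ := hT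
      obtain ⟨h0, h1, -⟩ := hflow.1 e he t ht
      exact ⟨h0.trans h1, hzle e he⟩
    · simp only [hz', if_neg he]
      exact ⟨le_rfl, hh.trans hC⟩
  · rw [hzv i hi]
    exact min_le_right _ _
  · refine add_le_add (Finset.sum_le_sum fun e he => ?_) (Finset.sum_le_sum fun i hi => ?_)
    · rw [hze e.1 e.2 he]
    · rw [hzv i hi]
      exact mul_le_mul_of_nonneg_left (min_le_left _ _) (hd i hi)

theorem isClosed_setOf_isMulticastFlow (N : DistributionNetwork V) :
    IsClosed {p : (V → Option V × Option V → ℝ) × (Option V × Option V → ℝ) |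
      N.IsMulticastFlow p.1 p.2} := by
  simp only [IsMulticastFlow, Set.ofPred_and, Set.ofPred_forall]
  refine IsClosed.inter ?_ ?_
  · refine isClosed_iInter fun e => isClosed_iInter fun _ => isClosed_iInter fun t =>
      isClosed_iInter fun _ => ?_
    refine (isClosed_le (by fun_prop) (by fun_prop)).inter
      ((isClosed_le (by fun_prop) (by fun_prop)).inter (isClosed_le ?_ continuous_const))
    exact continuous_coe_real_ereal.comp (by fun_prop)
  · refine isClosed_iInter fun i => isClosed_iInter fun t => isClosed_iInter fun _ => ?_
    exact isClosed_eq (by fun_prop) continuous_const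

/-- The minimum of CODED-MIN-COST is attained if the problem is feasible. -/
theorem exists_isLeast_codedValues (hT : N.T.Nonempty) (hd : ∀ i ∈ N.S, 0 ≤ N.d i)
    (hne : N.codedValues.Nonempty) : ∃ c, IsLeast N.codedValues c := by
  -- A product of intervals is compact by Tychonoff even for infinite `V`, and the cost is
  -- continuous because it is a finite sum over coordinates.
  set K : Set ((V → Option V × Option V → ℝ) × (Option V × Option V → ℝ)) :=
    (Set.univ.pi fun _ => Set.univ.pi fun _ => Set.Icc 0 N.flowBound) ×ˢ
      (Set.univ.pi fun _ => Set.Icc 0 N.flowBound) with hK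
  have hcompact : IsCompact (K ∩ {p | N.IsMulticastFlow p.1 p.2}) :=
    ((isCompact_univ_pi fun _ => isCompact_univ_pi fun _ => isCompact_Icc).prod
      (isCompact_univ_pi fun _ => isCompact_Icc)).inter_right N.isClosed_setOf_isMulticastFlow
  have hnorm : ∀ x z, N.IsMulticastFlow x z →
      ∃ p ∈ K ∩ {p | N.IsMulticastFlow p.1 p.2}, N.codedCost p.2 ≤ N.codedCost z := by
    intro x z hf
    obtain ⟨x', z', hf', hx, hz, -, hc⟩ := hf.exists_normalized hT hd
    exact ⟨(x', z'), ⟨⟨fun t _ e _ => hx t e, fun e _ => hz e⟩, hf'⟩, hc⟩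
  have hcont : Continuous fun p : (V → Option V × Option V → ℝ) × (Option V × Option V → ℝ) =>
      N.codedCost p.2 := by
    unfold codedCost flowCost
    fun_prop
  obtain ⟨-, x, z, hf, rfl⟩ := hne
  obtain ⟨p, hp, -⟩ := hnorm x z hf
  obtain ⟨q, hq, hmin⟩ := hcompact.exists_isMinOn ⟨p, hp⟩ hcont.continuousOn
  refine ⟨N.codedCost q.2, ⟨q.1, q.2, hq.2, rfl⟩, ?_⟩
  rintro _ ⟨x₁, z₁, hf₁, rfl⟩
  obtain ⟨r, hr, hrc⟩ := hnorm x₁ z₁ hf₁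
  exact (hmin hr).trans hrc

/-- The storage cost computed atom by atom is the storage cost computed source by source. -/
theorem sum_atoms_cost (N : DistributionNetwork V) (μ : Finset V → ℝ) :
    ∑ A ∈ N.atoms, (∑ i ∈ N.S with i ∈ A, N.d i) * μ A = ∑ i ∈ N.S, N.d i * N.entropy μ i := by
  simp only [entropy, Finset.sum_mul, Finset.mul_sum, Finset.sum_filter]
  rw [Finset.sum_comm]
  simp only [ite_mul, mul_ite, zero_mul, mul_zero]

theorem SubsetFeasible.subsetCost_eq {R : V → V → ℝ} {μ : Finset V → ℝ}
    (h : N.SubsetFeasible x z R μ) : N.subsetCost z μ = N.codedCost z := by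
  rw [subsetCost, codedCost, sum_atoms_cost]
  congr 1
  exact Finset.sum_congr rfl fun i hi => by rw [h.2.2.2.2.1 i hi]

theorem subsetValues_subset_codedValues (N : DistributionNetwork V) :
    N.subsetValues ⊆ N.codedValues := by
  rintro _ ⟨x, z, R, μ, h, rfl⟩
  exact ⟨x, z, h.1, h.subsetCost_eq.symm⟩

theorem finset_subset_pair_iff {A : Finset V} {a b : V} :
    A ⊆ {a, b} ↔ A = ∅ ∨ A = {a} ∨ A = {b} ∨ A = {a, b} := by
  have h := Set.subset_pair_iff_eq (s := (A : Set V)) (x := a) (y := b)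
  rw [← Finset.coe_subset, Finset.coe_pair, h]
  norm_cast

theorem atoms_eq_of_pair {a b : V} (hS : N.S = {a, b}) : N.atoms = {{a}, {b}, {a, b}} := by
  ext A
  simp only [atoms, hS, Finset.mem_filter, Finset.mem_powerset, Finset.mem_insert,
    Finset.mem_singleton, finset_subset_pair_iff]
  constructor
  · rintro ⟨rfl | h, hne⟩
    · simp at hne
    · exact h
  · rintro (rfl | rfl | rfl) <;> simp

/-- With two sources, a multicast flow storing at most `h` at each source is part of a feasible
point of SUBSET-MIN-COST. -/
theorem IsMulticastFlow.exists_subsetFeasible (hf : N.IsMulticastFlow x z) (hS : N.S.card = 2)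
    (hT : N.T.Nonempty) (hz : ∀ i ∈ N.S, z (none, some i) ≤ N.h) :
    ∃ R μ, N.SubsetFeasible x z R μ := by
  obtain ⟨a, b, hab, hSab⟩ := Finset.card_eq_two.1 hS
  have ha : a ∈ N.S := by simp [hSab]
  have hb : b ∈ N.S := by simp [hSab]
  have hat := atoms_eq_of_pair hSab
  have hne : ({a} : Finset V) ≠ {b} := by simpa using hab
  have hne1 : ({a} : Finset V) ≠ {a, b} := fun h => hab (by
    have : b ∈ ({a} : Finset V) := h ▸ by simp
    exact (Finset.mem_singleton.1 this).symm)
  have hne2 : ({b} : Finset V) ≠ {a, b} := fun h => hab (by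
    have : a ∈ ({b} : Finset V) := h ▸ by simp
    simpa using this)
  have hsum : ∀ t ∈ N.T, x t (none, some a) + x t (none, some b) = N.h := fun t ht => by
    rw [← hf.sum_virtual ht, hSab, Finset.sum_pair hab]
  have hxa : ∀ t ∈ N.T, x t (none, some a) ≤ z (none, some a) := fun t ht =>
    (hf.1 _ (virtual_mem_augEdges ha) t ht).2.1
  have hxb : ∀ t ∈ N.T, x t (none, some b) ≤ z (none, some b) := fun t ht =>
    (hf.1 _ (virtual_mem_augEdges hb) t ht).2.1
  -- These values are forced: they solve the linear system H(X_a) = z_a, H(X_b) = z_b, H(X_a, X_b) =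
  -- h.
  obtain ⟨μ, hμa, hμb, hμab⟩ : ∃ μ : Finset V → ℝ, μ {a} = N.h - z (none, some b) ∧
      μ {b} = N.h - z (none, some a) ∧
      μ {a, b} = z (none, some a) + z (none, some b) - N.h :=
    ⟨fun A => if A = {a} then N.h - z (none, some b) else if A = {b} then N.h - z (none, some a)
      else z (none, some a) + z (none, some b) - N.h, by simp, by simp [hne.symm],
      by simp [hne1.symm, hne2.symm]⟩
  have hatoms : ∀ g : Finset V → ℝ, ∑ A ∈ N.atoms, g A = g {a} + (g {b} + g {a, b}) := fun g => by
    rw [hat, Finset.sum_insert (by simp [hne, hne1]), Finset.sum_pair hne2]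
  refine ⟨fun t i => x t (none, some i), μ, hf, fun _ _ _ _ => le_rfl, fun t ht U hU => ?_,
    fun A hA => ?_, fun i hi => ?_, ?_⟩
  · have h1 := hsum t ht
    have h2 := hxa t ht
    have h3 := hxb t ht
    rw [condEntropy, Finset.sum_filter, hatoms, hSab]
    rw [hSab, finset_subset_pair_iff] at hU
    -- For `U = {a}` the inequality is h - z_b ≤ h - x_b = x_a, symmetrically for `{b}`; for `U =
    -- {a, b}` both sides equal h.
    rcases hU with rfl | rfl | rfl | rfl
    · simp
    · simp [hab, hab.symm, hμa]
      linarith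
    · simp [hab, hab.symm, hμb]
      linarith
    · rw [Finset.sum_pair hab]
      simp [hμa, hμb, hμab]
      linarith
  -- The singleton atoms are nonnegative by the truncation z ≤ h, the common atom because z_a + z_b
  -- ≥ x_a + x_b = h for any one terminal.
  · obtain ⟨t, ht⟩ := hT
    have h1 := hsum t ht
    have h2 := hxa t ht
    have h3 := hxb t ht
    have h4 := hz a ha
    have h5 := hz b hb
    rw [hat] at hA
    simp only [Finset.mem_insert, Finset.mem_singleton] at hA
    rcases hA with rfl | rfl | rfl <;> linarith
  · rw [entropy, Finset.sum_filter, hatoms]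
    rw [hSab] at hi
    simp only [Finset.mem_insert, Finset.mem_singleton] at hi
    rcases hi with rfl | rfl <;> simp [hab, hab.symm, hμa, hμb, hμab]
  · rw [jointEntropy, hatoms, hμa, hμb, hμab]
    ring

theorem exists_subsetValues_le (hS : N.S.card = 2) (hT : N.T.Nonempty)
    (hd : ∀ i ∈ N.S, 0 ≤ N.d i) {c : ℝ} (hc : c ∈ N.codedValues) :
    ∃ c' ∈ N.subsetValues, c' ≤ c := by
  obtain ⟨x, z, hf, rfl⟩ := hc
  obtain ⟨x', z', hf', -, -, hz, hc⟩ := hf.exists_normalized hT hd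
  obtain ⟨R, μ, hR⟩ := hf'.exists_subsetFeasible hS hT hz
  exact ⟨_, ⟨x', z', R, μ, hR, rfl⟩, hR.subsetCost_eq.trans_le hc⟩

end DistributionNetwork

theorem mainTheorem2 {V : Type*} [Fintype V] [DecidableEq V] (N : DistributionNetwork V)
    (hS : N.S.card = 2) (hT : N.T.Nonempty) (hd : ∀ i ∈ N.S, 0 ≤ N.d i) :
    N.subsetMinCost = N.codedMinCost ∧
    (N.subsetValues.Nonempty ↔ N.codedValues.Nonempty) ∧
    (N.codedValues.Nonempty →
      ∃ fopt : ℝ, IsLeast N.subsetValues fopt ∧ IsLeast N.codedValues fopt) := by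
  have hsub := N.subsetValues_subset_codedValues
  refine ⟨le_antisymm (le_sInf ?_) (sInf_le_sInf (Set.image_mono hsub)),
    ⟨fun h => h.mono hsub, ?_⟩, fun h => ?_⟩
  · rintro _ ⟨c, hc, rfl⟩
    obtain ⟨c', hc', hle⟩ := DistributionNetwork.exists_subsetValues_le hS hT hd hc
    exact (sInf_le (Set.mem_image_of_mem _ hc')).trans (EReal.coe_le_coe_iff.2 hle)
  · rintro ⟨c, hc⟩
    obtain ⟨c', hc', -⟩ := DistributionNetwork.exists_subsetValues_le hS hT hd hc
    exact ⟨c', hc'⟩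
  · obtain ⟨c, hc⟩ := DistributionNetwork.exists_isLeast_codedValues hT hd h
    obtain ⟨c', hc', hle⟩ := DistributionNetwork.exists_subsetValues_le hS hT hd hc.1
    -- `c'` is also a coded value, so minimality of `c` forces equality.
    obtain rfl : c' = c := le_antisymm hle (hc.2 (hsub hc'))
    exact ⟨c', ⟨hc', fun y hy => hc.2 (hsub hy)⟩, hc⟩
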